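/- Let $S$ be a (not necessarily commutative) semigroup, written additively. For a sequence $a_1,a_2,\dots$ in $S$, let $$\mathrm{FS}(a_1,a_2,\dots):=\{\,a_{i_1}+\cdots+a_{i_m} : m\ge 1,\ i_1<\cdots<i_m\,\}.$$ A subset of $S$ is a \emph{proper IP set} if it contains $\mathrm{FS}(a_1,a_2,\dots)$ for some sequence $a_1,a_2,\dots$ of pairwise distinct elements of $S$. A \emph{finite coloring} of $S$ is a function from $S$ to a finite set of colors, and a subset of $S$ is \emph{monochromatic} if all of its members have the same color. \textbf{Theorem.} Assume that for every finite coloring of $S$ there is a monochromatic proper IP set. Then, for every finite coloring of $S$, there are infinitely many pairwise disjoint monochromatic proper IP sets; moreover, they may all be taken to have the same color. -/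

import Mathlib

/-- A *proper IP set* in a (not necessarily commutative) semigroup, written additively: a set which
contains all finite sums `a i₁ + ⋯ + a iₘ` (`m ≥ 1`, `i₁ < ⋯ < iₘ`) of some sequence `a` of pairwise
distinct elements. The set of these finite sums is `Hindman.FS a`. -/
def IsProperIP {S : Type*} [AddSemigroup S] (A : Set S) : Prop :=
  ∃ a : Stream' S, Function.Injective a.get ∧ Hindman.FS a ⊆ A

/-- All members of the set `A` have the same color under the coloring `c`. -/
def IsMonochromatic {S κ : Type*} (c : S → κ) (A : Set S) : Prop :=
  ∃ i : κ, ∀ s ∈ A, c s = i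

open Filter

-- The proof splits on whether a free idempotent ultrafilter `p` exists.
--
-- If it does, `p` contains a color class, and countably many sequences are built in parallel inside
-- it, each new term being `p`-generic. A generic `y` keeps `f + y` away from a given `g` unless `f
-- + y = g` for `p`-almost all `y`; such forced values `g` are put into the set of `f` in advance
-- (`DisjointApprox`).
--
-- If it does not, some monochromatic `FS` set consists of idempotents, and a minimal closed
-- semigroup of ultrafilters yields a free `q` with `q + q` principal at some `e`
-- (`exists_isFree_add_self_eq_pure`). Hence there are sequences with `b i + b j = e = b i + e` for
-- `i < j`, whose finite sums are just `e` and the terms. Subsequences inherit this, so infinitely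
-- many such `e` with thinned-out sequences give the disjoint sets (`exists_disjoint_refinement`).

attribute [local instance] Ultrafilter.add Ultrafilter.addSemigroup

/-- An ultrafilter is free if it is not principal. -/
def Ultrafilter.IsFree {α : Type*} (p : Ultrafilter α) : Prop :=
  ∀ s, ∀ᶠ x in (p : Filter α), x ≠ s

theorem Ultrafilter.eq_pure_of_not_isFree {α : Type*} {p : Ultrafilter α} (hp : ¬ p.IsFree) :
    ∃ s, p = pure s := by
  simp only [Ultrafilter.IsFree, not_forall] at hp
  obtain ⟨s, hs⟩ := hp
  rw [← Ultrafilter.eventually_not] at hs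
  refine ⟨s, (Ultrafilter.coe_le_coe.1 ?_)⟩
  simpa [Filter.le_pure_iff, Filter.Eventually] using hs

theorem Ultrafilter.isClosed_setOf_isFree {α : Type*} :
    IsClosed {p : Ultrafilter α | p.IsFree} := by
  simp only [Ultrafilter.IsFree, Set.ofPred_forall]
  exact isClosed_iInter fun s => ultrafilter_isClosed_basic {x | x ≠ s}

theorem Ultrafilter.IsFree.ne_pure {α : Type*} {p : Ultrafilter α} (hp : p.IsFree) (s : α) :
    p ≠ pure s := by
  rintro rfl
  simpa using hp s

/-! ### Closed semigroups of ultrafilters -/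

section

variable {S : Type*} [AddSemigroup S]

/-- The ultrafilters that contain the finite sums of every tail of `a`. -/
def tailUltrafilters (a : Stream' S) : Set (Ultrafilter S) :=
  ⋂ n, {p : Ultrafilter S | Hindman.FS (a.drop n) ∈ p}

theorem isClosed_tailUltrafilters (a : Stream' S) : IsClosed (tailUltrafilters a) :=
  isClosed_iInter fun _ => ultrafilter_isClosed_basic _

theorem add_mem_tailUltrafilters {a : Stream' S} {p q : Ultrafilter S}
    (hp : p ∈ tailUltrafilters a) (hq : q ∈ tailUltrafilters a) : p + q ∈ tailUltrafilters a := by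
  simp only [tailUltrafilters, Set.mem_iInter, Set.mem_ofPred_eq] at *
  intro n
  change ∀ᶠ m in ((p + q : Ultrafilter S) : Filter S), m ∈ Hindman.FS (a.drop n)
  rw [Ultrafilter.eventually_add]
  filter_upwards [hp n] with m hm
  obtain ⟨n', hn⟩ := Hindman.FS.add hm
  filter_upwards [hq (n' + n)] with m' hm'
  apply hn
  simpa only [Stream'.drop_drop, add_comm] using hm'

theorem exists_isFree_mem_tailUltrafilters {a : Stream' S} (ha : Function.Injective a.get) :
    ∃ p ∈ tailUltrafilters a, p.IsFree := by
  refine ⟨(hyperfilter ℕ).map a.get, ?_, fun s => ?_⟩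
  · simp only [tailUltrafilters, Set.mem_iInter, Set.mem_ofPred_eq, Ultrafilter.mem_map]
    intro n
    filter_upwards [Nat.hyperfilter_le_atTop (eventually_ge_atTop n)] with m hm
    have : a.get m = (a.drop n).get (m - n) := by
      rw [Stream'.get_drop]; congr 1; omega
    simp only [Set.mem_preimage, this]
    exact Hindman.FS.singleton _ _
  · change ∀ᶠ x in map a.get (hyperfilter ℕ), x ≠ s
    rw [eventually_map]
    apply hyperfilter_le_cofinite
    have : {n | a.get n = s}.Finite :=
      Set.Subsingleton.finite fun m hm n hn => ha (hm.trans hn.symm)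
    change {n | a.get n ≠ s}ᶜ.Finite
    rwa [show {n | a.get n ≠ s}ᶜ = {n | a.get n = s} by ext; simp]

/-- In the absence of free idempotents, a closed semigroup of ultrafilters on idempotent elements
that contains a free ultrafilter contains a free one whose double is principal. -/
theorem exists_isFree_add_self_eq_pure
    (hno : ∀ p : Ultrafilter S, p.IsFree → p + p ≠ p) {R : Set (Ultrafilter S)}
    (hRc : IsClosed R) (hRa : ∀ p ∈ R, ∀ q ∈ R, p + q ∈ R)
    (hRi : ∀ p ∈ R, ∀ᶠ x in (p : Filter S), x + x = x) (hRf : ∃ p ∈ R, p.IsFree) :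
    ∃ q ∈ R, q.IsFree ∧ ∃ h, q + q = pure h := by
  let Z : Set (Set (Ultrafilter S)) :=
    {N | N ⊆ R ∧ IsClosed N ∧ (∀ p ∈ N, ∀ q ∈ N, p + q ∈ N) ∧ ∃ p ∈ N, p.IsFree}
  obtain ⟨T, hT⟩ : ∃ T, Minimal (· ∈ Z) T := by
    suffices H : ∀ C ⊆ Z, IsChain (· ⊆ ·) C → C.Nonempty → ∃ lb ∈ Z, ∀ s ∈ C, lb ⊆ s by
      obtain ⟨T, -, hT⟩ := zorn_superset_nonempty Z H R ⟨subset_rfl, hRc, hRa, hRf⟩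
      exact ⟨T, hT⟩
    intro C hCZ hC hCne
    refine ⟨⋂₀ C, ⟨?_, ?_, ?_, ?_⟩, fun s hs => Set.sInter_subset_of_mem hs⟩
    · obtain ⟨N, hN⟩ := hCne
      exact (Set.sInter_subset_of_mem hN).trans (hCZ hN).1
    · exact isClosed_sInter fun N hN => (hCZ hN).2.1
    · exact fun p hp q hq N hN => (hCZ hN).2.2.1 p (hp N hN) q (hq N hN)
    -- Free ultrafilters form a closed set, so compactness keeps one in the intersection of the
    -- chain.
    · have hne : (⋂₀ ((fun N => N ∩ {p : Ultrafilter S | p.IsFree}) '' C)).Nonempty := by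
        refine IsCompact.nonempty_sInter_of_directed_nonempty_isCompact_isClosed ?_ ?_ ?_ ?_
          (hS := (hCne.image _).to_subtype)
        · rintro _ ⟨M, hM, rfl⟩ _ ⟨N, hN, rfl⟩
          rcases hC.total hM hN with h | h
          · exact ⟨_, ⟨M, hM, rfl⟩, subset_rfl, Set.inter_subset_inter_left _ h⟩
          · exact ⟨_, ⟨N, hN, rfl⟩, Set.inter_subset_inter_left _ h, subset_rfl⟩
        · rintro _ ⟨N, hN, rfl⟩
          obtain ⟨p, hp⟩ := (hCZ hN).2.2.2
          exact ⟨p, hp⟩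
        · rintro _ ⟨N, hN, rfl⟩
          exact ((hCZ hN).2.1.inter Ultrafilter.isClosed_setOf_isFree).isCompact
        · rintro _ ⟨N, hN, rfl⟩
          exact (hCZ hN).2.1.inter Ultrafilter.isClosed_setOf_isFree
      obtain ⟨p, hp⟩ := hne
      obtain ⟨N, hN⟩ := hCne
      exact ⟨p, fun M hM => (hp _ ⟨M, hM, rfl⟩).1, (hp _ ⟨N, hN, rfl⟩).2⟩
  obtain ⟨hTR, hTc, hTa, q, hqT, hq⟩ := hT.prop
  have hmin : ∀ N : Set (Ultrafilter S), N ⊆ T → IsClosed N → (∀ p ∈ N, ∀ q ∈ N, p + q ∈ N) →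
      (∃ p ∈ N, p.IsFree) → N = T := fun N h1 h2 h3 h4 =>
    (hT.eq_of_subset ⟨h1.trans hTR, h2, h3, h4⟩ h1)
  refine ⟨q, hTR hqT, hq, ?_⟩
  by_contra! hcon
  have hqq : (q + q).IsFree := by
    by_contra h
    obtain ⟨s, hs⟩ := Ultrafilter.eq_pure_of_not_isFree h
    exact hcon s hs
  -- `T + q` is a closed semigroup containing the free `q + q`. By minimality it is `T`, so `t + q =
  -- q` is solvable in `T`, and the solutions form a compact semigroup with an idempotent.
  have himg : (· + q) '' T = T := by
    apply hmin
    · rintro _ ⟨t, ht, rfl⟩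
      exact hTa _ ht _ hqT
    · exact (hTc.isCompact.image (Ultrafilter.continuous_add_left q)).isClosed
    · rintro _ ⟨t, ht, rfl⟩ _ ⟨u, hu, rfl⟩
      exact ⟨t + q + u, hTa _ (hTa _ ht _ hqT) _ hu, by simp only [add_assoc]⟩
    · exact ⟨q + q, ⟨q, hqT, rfl⟩, hqq⟩
  obtain ⟨e, ⟨heT, heq⟩, hee⟩ := exists_idempotent_in_compact_add_subsemigroup
    (fun r => Ultrafilter.continuous_add_left r) {t | t ∈ T ∧ t + q = q}
    (by obtain ⟨t, ht, h⟩ := himg.symm ▸ hqT; exact ⟨t, ht, h⟩)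
    ((hTc.inter (isClosed_singleton.preimage (Ultrafilter.continuous_add_left q))).isCompact)
    (by rintro t ⟨ht, h⟩ u ⟨hu, h'⟩; exact ⟨hTa _ ht _ hu, by rw [add_assoc, h', h]⟩)
  obtain ⟨h, rfl⟩ : ∃ h, e = pure h := by
    by_contra! hc
    refine hno e ?_ hee
    by_contra hf
    obtain ⟨s, hs⟩ := Ultrafilter.eq_pure_of_not_isFree hf
    exact hc s hs
  have hhh : h + h = h := by
    have := hRi _ (hTR heT)
    simpa using this
  have hD : ∀ᶠ b in q, h + b = b := by
    have : ∀ᶠ b in ((pure h + q : Ultrafilter S) : Filter S), h + b = b := by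
      rw [Ultrafilter.eventually_add]
      simp [← add_assoc, hhh]
    rwa [heq] at this
  have hDT : T ∩ {t : Ultrafilter S | {b | h + b = b} ∈ t} = T := by
    apply hmin _ Set.inter_subset_left (hTc.inter (ultrafilter_isClosed_basic _))
    · rintro t ⟨ht, h1⟩ u ⟨hu, h2⟩
      refine ⟨hTa _ ht _ hu, ?_⟩
      change ∀ᶠ b in ((t + u : Ultrafilter S) : Filter S), h + b = b
      rw [Ultrafilter.eventually_add]
      filter_upwards [h1] with x (hx : h + x = x)
      simp [← add_assoc, hx]
    · exact ⟨q, ⟨hqT, hD⟩, hq⟩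
  have hpure : IsOpen ({pure h} : Set (Ultrafilter S)) := by
    convert ultrafilter_isOpen_basic {h}
    ext u
    simp only [Set.mem_singleton_iff, Set.mem_ofPred_eq]
    constructor
    · rintro rfl; simp
    · intro hu
      exact Ultrafilter.coe_le_coe.1 (by simpa [Filter.le_pure_iff] using hu)
  -- Removing the isolated point `pure h` leaves a semigroup: if `t + u = pure h`, then for some `x`
  -- and `u`-almost all `y`, `y = h + y = x + y + y = x + y = h`, so `u = pure h`. This contradicts
  -- minimality.
  have hrest : T \ {pure h} = T := by
    apply hmin _ Set.sdiff_subset (hTc.sdiff hpure)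
    · rintro t ⟨ht, -⟩ u ⟨hu, h2⟩
      refine ⟨hTa _ ht _ hu, fun htu => h2 ?_⟩
      have h3 : ∀ᶠ x in ((t + u : Ultrafilter S) : Filter S), x = h := by
        rw [Set.mem_singleton_iff.1 htu]; simp
      rw [Ultrafilter.eventually_add] at h3
      obtain ⟨x, hx⟩ := h3.exists
      have h4 : {b | h + b = b} ∈ u := (hDT.symm ▸ hu : u ∈ T ∩ _).2
      have h5 : ∀ᶠ y in u, y = h := by
        filter_upwards [hx, h4, hRi _ (hTR hu)] with y hy (hy' : h + y = y) hyy
        rw [← hy', ← hy, add_assoc, hyy]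
      exact Ultrafilter.coe_le_coe.1 (by simpa [Filter.le_pure_iff, Filter.Eventually] using h5)
    · exact ⟨q, ⟨hqT, hq.ne_pure h⟩, hq⟩
  exact (hrest.symm ▸ heT : pure h ∈ T \ {pure h}).2 rfl

end

/-! ### The case of a free idempotent -/

section

variable {S : Type*} [AddSemigroup S]

/-- Finite approximations to a sequence of disjoint monochromatic proper IP sets, relative to an
idempotent ultrafilter `p`. The sets are closed under adding `p` on the right whenever the result is
principal, so that later elements of different sets can be kept apart. -/
structure DisjointApprox {κ : Type*} (p : Ultrafilter S) (c : S → κ) (i : κ) (G : ℕ → Set S) :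
    Prop where
  finite : (⋃ k, G k).Finite
  color : ∀ k, ∀ f ∈ G k, c f = i
  eventually_color : ∀ k, ∀ f ∈ G k, ∀ᶠ y in (p : Filter S), c (f + y) = i
  disjoint : ∀ j k f, f ∈ G j → f ∈ G k → j = k
  closed : ∀ k, ∀ f ∈ G k, ∀ g, (∀ᶠ y in (p : Filter S), f + y = g) → g ∈ G k

theorem Ultrafilter.eventually_eventually_add {p : Ultrafilter S} (hp : p + p = p) {P : S → Prop} :
    (∀ᶠ x in (p : Filter S), P x) ↔
      ∀ᶠ x in (p : Filter S), ∀ᶠ y in (p : Filter S), P (x + y) := by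
  conv_lhs => rw [← hp]
  exact Ultrafilter.eventually_add p p P

/-- Finitely many conditions are imposed on `a`, each true for `p`-almost all `a`. Idempotence also
gives them for `a + y` and `f + a + y`, which controls the forced values added by closing up. -/
theorem DisjointApprox.exists_extension {κ : Type*} {p : Ultrafilter S} (hp : p.IsFree)
    (hpp : p + p = p) {c : S → κ} {i : κ} (hc : ∀ᶠ x in (p : Filter S), c x = i) {G : ℕ → Set S}
    (hG : DisjointApprox p c i G) (k : ℕ) :
    ∃ G' : ℕ → Set S, DisjointApprox p c i G' ∧ (∀ j, G j ⊆ G' j) ∧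
      ∃ a ∈ G' k, (∀ j, a ∉ G j) ∧ ∀ f ∈ G k, f + a ∈ G' k := by
  have hfin : ∀ j, (G j).Finite := fun j => hG.finite.subset (Set.subset_iUnion G j)
  have h1 : ∀ᶠ a in (p : Filter S), ∀ g ∈ ⋃ j, G j,
      a ≠ g ∧ ¬ ∀ᶠ y in (p : Filter S), a + y = g := by
    refine hG.finite.eventually_all.2 fun g _ => (hp g).and ?_
    rw [Ultrafilter.eventually_not, ← Ultrafilter.eventually_eventually_add hpp (P := (· = g)),
      ← Ultrafilter.eventually_not]
    exact hp g
  have h2 : ∀ᶠ a in (p : Filter S), ∀ g ∈ ⋃ j, G j, ∀ f ∈ G k, g ∉ G k →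
      f + a ≠ g ∧ ¬ ∀ᶠ y in (p : Filter S), f + a + y = g := by
    refine hG.finite.eventually_all.2 fun g _ => (hfin k).eventually_all.2 fun f hf => ?_
    by_cases hg : g ∈ G k
    · simp [hg]
    have h : ¬ ∀ᶠ a in (p : Filter S), f + a = g := fun h => hg (hG.closed k f hf g h)
    have h' := h
    rw [Ultrafilter.eventually_eventually_add hpp, ← Ultrafilter.eventually_not] at h'
    rw [← Ultrafilter.eventually_not] at h
    filter_upwards [h, h'] with a ha ha' _
    exact ⟨ha, by simpa only [add_assoc] using ha'⟩
  have h3 : ∀ᶠ a in (p : Filter S), ∀ f ∈ G k,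
      c (f + a) = i ∧ ∀ᶠ y in (p : Filter S), c (f + a + y) = i := by
    refine (hfin k).eventually_all.2 fun f hf => ?_
    have h := hG.eventually_color k f hf
    refine h.and ?_
    rw [Ultrafilter.eventually_eventually_add hpp] at h
    simpa only [add_assoc] using h
  have h4 := (Ultrafilter.eventually_eventually_add hpp).1 hc
  obtain ⟨a, h1, h2, h3, hca, hcay⟩ := (h1.and (h2.and (h3.and (hc.and h4)))).exists
  let N : Set S := insert a ((· + a) '' G k)
  -- One round of closing up suffices: by idempotence, a value forced by a forced value of `x` is
  -- already forced by `x`.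
  let C : Set S := N ∪ {g | ∃ x ∈ N, ∀ᶠ y in (p : Filter S), x + y = g}
  have hNfin : N.Finite := ((hfin k).image _).insert a
  have hCfin : C.Finite := by
    refine hNfin.union ?_
    have : {g | ∃ x ∈ N, ∀ᶠ y in (p : Filter S), x + y = g} =
        ⋃ x ∈ N, {g | ∀ᶠ y in (p : Filter S), x + y = g} := by ext; simp
    rw [this]
    refine hNfin.biUnion fun x _ => Set.Subsingleton.finite fun g hg g' hg' => ?_
    obtain ⟨y, hy, hy'⟩ := (Filter.Eventually.and hg hg').exists
    exact hy.symm.trans hy'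
  have hNcol : ∀ x ∈ N, c x = i ∧ ∀ᶠ y in (p : Filter S), c (x + y) = i := by
    rintro _ (rfl | ⟨f, hf, rfl⟩)
    · exact ⟨hca, hcay⟩
    · exact h3 f hf
  have hCcol : ∀ x ∈ C, c x = i ∧ ∀ᶠ y in (p : Filter S), c (x + y) = i := by
    rintro z (hz | ⟨x, hx, hz⟩)
    · exact hNcol z hz
    have h := (hNcol x hx).2
    constructor
    · obtain ⟨y, hy, hy'⟩ := (h.and hz).exists
      rw [← hy', hy]
    · obtain ⟨y, hy, hy'⟩ :=
        (((Ultrafilter.eventually_eventually_add hpp).1 h).and hz).exists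
      simpa only [← add_assoc, hy'] using hy
  have hNnot : ∀ x ∈ N, ∀ j, j ≠ k → x ∉ G j ∧ ∀ g ∈ G j, ¬ ∀ᶠ y in (p : Filter S), x + y = g := by
    rintro _ (rfl | ⟨f, hf, rfl⟩) j hj
    · exact ⟨fun h => (h1 _ (Set.mem_iUnion_of_mem j h)).1 rfl,
        fun g hg => (h1 g (Set.mem_iUnion_of_mem j hg)).2⟩
    · exact ⟨fun h => (h2 _ (Set.mem_iUnion_of_mem j h) f hf
          fun h' => hj (hG.disjoint _ _ _ h h')).1 rfl,
        fun g hg => (h2 g (Set.mem_iUnion_of_mem j hg) f hf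
          fun h' => hj (hG.disjoint _ _ _ hg h')).2⟩
  have hCnot : ∀ x ∈ C, ∀ j, j ≠ k → x ∉ G j := by
    rintro z (hz | ⟨x, hx, hz⟩) j hj
    · exact (hNnot z hz j hj).1
    · exact fun h => (hNnot x hx j hj).2 z h hz
  have hmem : ∀ j x, x ∈ Function.update G k (G k ∪ C) j ↔ x ∈ G j ∨ (j = k ∧ x ∈ C) := by
    intro j x
    by_cases hj : j = k
    · subst hj; simp
    · simp [hj]
  refine ⟨Function.update G k (G k ∪ C), ⟨?_, ?_, ?_, ?_, ?_⟩, ?_, a, ?_, ?_, ?_⟩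
  · refine (hG.finite.union hCfin).subset (Set.iUnion_subset fun j x hx => ?_)
    rcases (hmem j x).1 hx with h | h
    · exact Or.inl (Set.mem_iUnion_of_mem j h)
    · exact Or.inr h.2
  · intro j f hf
    rcases (hmem j f).1 hf with h | h
    · exact hG.color j f h
    · exact (hCcol f h.2).1
  · intro j f hf
    rcases (hmem j f).1 hf with h | h
    · exact hG.eventually_color j f h
    · exact (hCcol f h.2).2
  · intro j l f hj hl
    rcases (hmem j f).1 hj with h | ⟨rfl, h⟩ <;> rcases (hmem l f).1 hl with h' | ⟨rfl, h'⟩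
    · exact hG.disjoint j l f h h'
    · by_contra hne
      exact hCnot f h' j hne h
    · by_contra hne
      exact hCnot f h l (Ne.symm hne) h'
    · rfl
  · intro j f hf g hg
    rw [hmem]
    rcases (hmem j f).1 hf with h | ⟨rfl, h | ⟨x, hx, h⟩⟩
    · exact Or.inl (hG.closed j f h g hg)
    · exact Or.inr ⟨rfl, Or.inr ⟨f, h, hg⟩⟩
    · refine Or.inr ⟨rfl, Or.inr ⟨x, hx, ?_⟩⟩
      rw [Ultrafilter.eventually_eventually_add hpp]
      filter_upwards [h] with y hy
      simpa only [← add_assoc, hy] using hg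
  · exact fun j x hx => (hmem j x).2 (Or.inl hx)
  · exact (hmem k a).2 (Or.inr ⟨rfl, Or.inl (Or.inl rfl)⟩)
  · exact fun j h => (h1 _ (Set.mem_iUnion_of_mem j h)).1 rfl
  · exact fun f hf => (hmem k _).2 (Or.inr ⟨rfl, Or.inl (Or.inr ⟨f, hf, rfl⟩)⟩)

theorem exists_disjoint_isProperIP_of_idempotent {κ : Type*} {p : Ultrafilter S} (hp : p.IsFree)
    (hpp : p + p = p) {c : S → κ} {i : κ} (hc : ∀ᶠ x in (p : Filter S), c x = i) :
    ∃ A : ℕ → Set S, (∀ n, IsProperIP (A n)) ∧ (∀ m n, m ≠ n → Disjoint (A m) (A n)) ∧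
      IsMonochromatic c (⋃ n, A n) := by
  choose! E hE hEG a haE haG hadd using
    fun (G : ℕ → Set S) (hG : DisjointApprox p c i G) => hG.exists_extension hp hpp hc
  -- Stage `Nat.pair k n` adds the `n`-th term of the `k`-th sequence.
  let G : ℕ → ℕ → Set S := fun t => Nat.rec (fun _ => ∅) (fun t H => E H (Nat.unpair t).1) t
  have hsucc : ∀ t, G (t + 1) = E (G t) (Nat.unpair t).1 := fun t => rfl
  have hG : ∀ t, DisjointApprox p c i (G t) := by
    intro t
    induction t with
    | zero => constructor <;> simp [G]
    | succ t ih => exact hE _ ih _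
  have hmono : ∀ k, Monotone fun t => G t k := fun k =>
    monotone_nat_of_le_succ fun t => hEG _ (hG t) _ k
  let b : ℕ → Stream' S := fun k n => a (G (Nat.pair k n)) (hG _) k
  have hb : ∀ k n, (b k).get n ∈ G (Nat.pair k n + 1) k := by
    intro k n
    have := haE _ (hG (Nat.pair k n)) k
    rw [hsucc, Nat.unpair_pair]
    exact this
  have hb' : ∀ k n, ∀ f ∈ G (Nat.pair k n) k, f + (b k).get n ∈ G (Nat.pair k n + 1) k := by
    intro k n f hf
    have := hadd _ (hG (Nat.pair k n)) k f hf
    rw [hsucc, Nat.unpair_pair]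
    exact this
  have hbn : ∀ k n, (b k).get n ∉ G (Nat.pair k n) k := fun k n => haG _ (hG _) k k
  have hpair : ∀ k n, Nat.pair k n + 1 ≤ Nat.pair k (n + 1) := fun k n =>
    Nat.pair_lt_pair_right k n.lt_succ_self
  refine ⟨fun k => ⋃ t, G t k, fun k => ⟨b k, ?_, ?_⟩, ?_, i, ?_⟩
  · refine Function.Injective.of_lt_imp_ne fun m n hmn h => hbn k n ?_
    change (b k).get m = (b k).get n at h
    rw [← h]
    exact hmono k (Nat.pair_lt_pair_right k hmn) (hb k m)
  -- `FS` recurses from the head, whereas the approximations grow by adding terms on the right; the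
  -- induction therefore carries a prefix `f` built earlier.
  · suffices H : ∀ (s : Stream' S) (m : S), m ∈ Hindman.FS s → ∀ n, s = (b k).drop n →
        m ∈ (⋃ t, G t k) ∧ ∀ f ∈ G (Nat.pair k n) k, f + m ∈ ⋃ t, G t k from
      fun m hm => (H _ m hm 0 rfl).1
    intro s m hm
    induction hm with
    | head' s =>
      rintro n rfl
      rw [Stream'.head_drop]
      exact ⟨Set.mem_iUnion.2 ⟨Nat.pair k n + 1, hb k n⟩, fun f hf =>
        Set.mem_iUnion.2 ⟨Nat.pair k n + 1, hb' k n f hf⟩⟩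
    | tail' s m _ ih =>
      rintro n rfl
      obtain ⟨h1, h2⟩ := ih (n + 1) (by rw [Stream'.tail_drop'])
      exact ⟨h1, fun f hf => h2 f (hmono k ((Nat.le_succ _).trans (hpair k n)) hf)⟩
    | cons' s m _ ih =>
      rintro n rfl
      obtain ⟨h1, h2⟩ := ih (n + 1) (by rw [Stream'.tail_drop'])
      rw [Stream'.head_drop]
      refine ⟨h2 _ (hmono k (hpair k n) (hb k n)), fun f hf => ?_⟩
      rw [← add_assoc]
      exact h2 _ (hmono k (hpair k n) (hb' k n f hf))
  · intro m n hmn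
    rw [Set.disjoint_left]
    intro x hx hx'
    obtain ⟨t, ht⟩ := Set.mem_iUnion.1 hx
    obtain ⟨u, hu⟩ := Set.mem_iUnion.1 hx'
    exact hmn ((hG (max t u)).disjoint m n x (hmono m (le_max_left t u) ht)
      (hmono n (le_max_right t u) hu))
  · simp only [Set.mem_iUnion]
    rintro x ⟨k, t, hx⟩
    exact (hG t).color k x hx

end

/-! ### Choosing disjoint infinite subsets -/

theorem exists_seq_of_forall_history {α : Type*} (P : (n : ℕ) → ((m : ℕ) → m < n → α) → α → Prop)
    (h : ∀ n H, ∃ x, P n H x) : ∃ f : ℕ → α, ∀ n, P n (fun m _ => f m) (f n) := by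
  choose F hF using h
  refine ⟨Nat.lt_wfRel.wf.fix F, fun n => ?_⟩
  conv => arg 3; rw [WellFounded.fix_eq]
  exact hF n _

/-- If arbitrarily many points `e` have an attached infinite set, then infinitely many of these
points can be chosen, together with disjoint infinite subsets of the attached sets that avoid all
chosen points. -/
theorem exists_disjoint_refinement {α : Type*} (Q : α → Set α → Prop)
    (hQ : ∀ F : Set α, F.Finite → ∃ e ∉ F, ∃ B : Set α, B.Infinite ∧ Q e B) :
    ∃ (e : ℕ → α) (B Y : ℕ → Set α), (∀ n, Q (e n) (B n)) ∧ (∀ n, Y n ⊆ B n) ∧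
      (∀ n, (Y n).Infinite) ∧
      ∀ m n, m ≠ n → Disjoint (insert (e m) (Y m)) (insert (e n) (Y n)) := by
  -- Step `n` picks a triple `(e, B, y)`, with `y` taken from the set `B` of step `(Nat.unpair n).1
  -- ≤ n`, so each set is visited infinitely often. The last clause covers equality, where that set
  -- is the one just chosen.
  let P : (n : ℕ) → ((m : ℕ) → m < n → α × {B : Set α // B.Infinite} × α) →
      α × {B : Set α // B.Infinite} × α → Prop := fun n H x =>
    Q x.1 x.2.1 ∧ x.2.2 ≠ x.1 ∧
    (∀ m hm, x.1 ≠ (H m hm).1 ∧ x.1 ≠ (H m hm).2.2 ∧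
      x.2.2 ≠ (H m hm).1 ∧ x.2.2 ≠ (H m hm).2.2) ∧
    (∀ hk : (Nat.unpair n).1 < n, x.2.2 ∈ (H _ hk).2.1.1) ∧
    ((Nat.unpair n).1 = n → x.2.2 ∈ x.2.1.1)
  obtain ⟨f, hf⟩ := exists_seq_of_forall_history P (fun n H => by
    let F : Set α := Set.range (fun m : Fin n => (H m m.2).1) ∪
      Set.range (fun m : Fin n => (H m m.2).2.2)
    have hF : F.Finite := (Set.finite_range _).union (Set.finite_range _)
    have h1 : ∀ m hm, (H m hm).1 ∈ F := fun m hm => Or.inl ⟨⟨m, hm⟩, rfl⟩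
    have h2 : ∀ m hm, (H m hm).2.2 ∈ F := fun m hm => Or.inr ⟨⟨m, hm⟩, rfl⟩
    obtain ⟨e, he, B, hB, hQe⟩ := hQ F hF
    obtain ⟨C, hC, hCH, hCB⟩ : ∃ C : Set α, C.Infinite ∧
        (∀ hk : (Nat.unpair n).1 < n, C = (H _ hk).2.1.1) ∧ ((Nat.unpair n).1 = n → C = B) := by
      rcases (Nat.unpair_left_le n).lt_or_eq with hk | hk
      · exact ⟨(H _ hk).2.1.1, (H _ hk).2.1.2, fun _ => rfl, fun h => absurd h hk.ne⟩
      · exact ⟨B, hB, fun h => absurd hk h.ne, fun _ => rfl⟩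
    obtain ⟨y, hyC, hy⟩ := hC.exists_notMem_finite (hF.insert e)
    rw [Set.mem_insert_iff, not_or] at hy
    refine ⟨(e, ⟨B, hB⟩, y), hQe, hy.1, fun m hm => ⟨?_, ?_, ?_, ?_⟩,
      fun hk => hCH hk ▸ hyC, fun hk => hCB hk ▸ hyC⟩
    · exact fun (h : e = _) => he (h ▸ h1 m hm)
    · exact fun (h : e = _) => he (h ▸ h2 m hm)
    · exact fun (h : y = _) => hy.2 (h ▸ h1 m hm)
    · exact fun (h : y = _) => hy.2 (h ▸ h2 m hm))
  have hee : ∀ m n, m ≠ n → (f m).1 ≠ (f n).1 := by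
    intro m n hmn
    rcases hmn.lt_or_gt with h | h
    · exact ((hf n).2.2.1 m h).1.symm
    · exact ((hf m).2.2.1 n h).1
  have hyy : ∀ m n, m ≠ n → (f m).2.2 ≠ (f n).2.2 := by
    intro m n hmn
    rcases hmn.lt_or_gt with h | h
    · exact ((hf n).2.2.1 m h).2.2.2.symm
    · exact ((hf m).2.2.1 n h).2.2.2
  have hey : ∀ m n, (f m).1 ≠ (f n).2.2 := by
    intro m n
    rcases lt_trichotomy m n with h | rfl | h
    · exact ((hf n).2.2.1 m h).2.2.1.symm
    · exact (hf m).2.1.symm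
    · exact ((hf m).2.2.1 n h).2.1
  refine ⟨fun n => (f n).1, fun n => (f n).2.1, fun k => Set.range fun n => (f (Nat.pair k n)).2.2,
    fun n => (hf n).1, ?_, fun k => Set.infinite_range_of_injective ?_, ?_⟩
  · rintro k _ ⟨n, rfl⟩
    have h1 := (hf (Nat.pair k n)).2.2.2.1
    have h2 := (hf (Nat.pair k n)).2.2.2.2
    rw [Nat.unpair_pair] at h1 h2
    rcases (Nat.left_le_pair k n).lt_or_eq with h | h
    · exact h1 h
    · have := h2 h
      rw [← h] at this
      change (f (Nat.pair k n)).2.2 ∈ _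
      rwa [← h]
  · refine fun m n h => by_contra fun hmn => hyy _ _ (fun h' => hmn ?_) h
    exact (Nat.pair_eq_pair.1 h').2
  · intro j k hjk
    rw [Set.disjoint_left]
    rintro _ (rfl | ⟨m, rfl⟩) (h | ⟨n, h⟩)
    · exact hee _ _ hjk h
    · exact hey _ _ h.symm
    · exact hey _ _ h.symm
    · exact hyy _ _ (fun h' => hjk (Nat.pair_eq_pair.1 h').1.symm) h

/-! ### The case without free idempotents -/

section

variable {S : Type*} [AddSemigroup S]

theorem Hindman.FS_subset_insert_of_add_eq {e : S} {s : Stream' S}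
    (hs : ∀ i j, i < j → s.get i + s.get j = e) (he : ∀ i, s.get i + e = e) :
    Hindman.FS s ⊆ insert e (Set.range s.get) := by
  intro m hm
  induction hm with
  | head' s => exact Or.inr ⟨0, rfl⟩
  | tail' s m _ ih =>
    rcases ih (fun i j h => hs (i + 1) (j + 1) (Nat.succ_lt_succ h)) (fun i => he (i + 1)) with
      h | ⟨n, h⟩
    · exact Or.inl h
    · exact Or.inr ⟨n + 1, h⟩
  | cons' s m _ ih =>
    rcases ih (fun i j h => hs (i + 1) (j + 1) (Nat.succ_lt_succ h)) (fun i => he (i + 1)) with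
      rfl | ⟨n, rfl⟩
    · exact Or.inl (he 0)
    · exact Or.inl (hs 0 (n + 1) n.succ_pos)

/-- All sums of two or more elements of the infinite set `B`, in the order of some enumeration,
are equal to `e`, also if `e` itself is added on the right. -/
def IsNilEnumerable (e : S) (B : Set S) : Prop :=
  ∃ b : ℕ → S, Function.Injective b ∧ Set.range b = B ∧ (∀ i j, i < j → b i + b j = e) ∧
    ∀ i, b i + e = e

theorem IsNilEnumerable.isProperIP {e : S} {B Y : Set S} (h : IsNilEnumerable e B) (hYB : Y ⊆ B)
    (hY : Y.Infinite) : IsProperIP (insert e Y) := by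
  classical
  obtain ⟨b, hb, rfl, hbb, hbe⟩ := h
  have hinf : (b ⁻¹' Y).Infinite := hY.preimage hYB
  have := hinf.to_subtype
  let φ := Nat.orderEmbeddingOfSet (b ⁻¹' Y)
  refine ⟨fun n => b (φ n), hb.comp φ.injective, ?_⟩
  refine (Hindman.FS_subset_insert_of_add_eq (e := e) (fun i j hij => ?_) fun i => ?_).trans
    (Set.insert_subset_insert ?_)
  · exact hbb _ _ (φ.strictMono hij)
  · exact hbe _
  · rintro _ ⟨n, rfl⟩
    have : φ n ∈ Set.range φ := ⟨n, rfl⟩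
    rwa [Nat.orderEmbeddingOfSet_range] at this

theorem exists_isProperIP_isMonochromatic_of_finite {κ : Type*} [Finite κ]
    (hS : ∀ (r : ℕ) (c : S → Fin r), ∃ A : Set S, IsProperIP A ∧ IsMonochromatic c A)
    (c : S → κ) : ∃ A : Set S, IsProperIP A ∧ IsMonochromatic c A := by
  obtain ⟨r, ⟨e⟩⟩ := Finite.exists_equiv_fin κ
  obtain ⟨A, hA, i, hi⟩ := hS r (e ∘ c)
  exact ⟨A, hA, e.symm i, fun s hs => by simp [← hi s hs]⟩

theorem exists_isNilEnumerable {κ : Type*} [Finite κ]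
    (hS : ∀ (r : ℕ) (c : S → Fin r), ∃ A : Set S, IsProperIP A ∧ IsMonochromatic c A)
    (hno : ∀ p : Ultrafilter S, p.IsFree → p + p ≠ p) (c : S → κ) {F : Set S} (hF : F.Finite) :
    ∃ i : κ, ∃ e ∉ F, c e = i ∧ ∃ B : Set S, (∀ x ∈ B, c x = i) ∧ IsNilEnumerable e B := by
  classical
  have := hF.to_subtype
  -- The refined coloring also records idempotence and isolates each point of `F`; a class that
  -- meets `F` is a singleton, too small for a proper IP set.
  obtain ⟨A, ⟨a, ha, haA⟩, ⟨i, u, v⟩, hi⟩ := exists_isProperIP_isMonochromatic_of_finite hS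
    (fun s => (c s, (s + s = s : Prop), if h : s ∈ F then some (⟨s, h⟩ : F) else none))
  simp only [Prod.mk.injEq] at hi
  have hidem : ∀ s ∈ Hindman.FS a, s + s = s := by
    -- Hindman's idempotent ultrafilter must be principal here, so `FS a` contains one idempotent,
    -- and by the coloring only idempotents.
    obtain ⟨U, hU, hUa⟩ := Hindman.exists_idempotent_ultrafilter_le_FS a
    obtain ⟨e, rfl⟩ := Ultrafilter.eq_pure_of_not_isFree fun h => hno U h hU
    have hea : e ∈ Hindman.FS a := by simpa using hUa
    have hee : e + e = e := by
      have : ∀ᶠ x in ((pure e : Ultrafilter S) : Filter S), x = e := by simp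
      rw [← hU, Ultrafilter.eventually_add] at this
      simpa using this
    intro s hs
    rw [(hi s (haA hs)).2.1, ← (hi e (haA hea)).2.1]
    exact hee
  have htail : ∀ p ∈ tailUltrafilters a, ∀ᶠ x in (p : Filter S), x ∈ Hindman.FS a :=
    fun p hp => Set.mem_iInter.1 hp 0
  obtain ⟨q, hq, hqf, e, hqe⟩ := exists_isFree_add_self_eq_pure hno (isClosed_tailUltrafilters a)
    (fun p hp q hq => add_mem_tailUltrafilters hp hq)
    (fun p hp => (htail p hp).mono hidem) (exists_isFree_mem_tailUltrafilters ha)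
  have heA : e ∈ A := by
    have := htail _ (add_mem_tailUltrafilters hq hq)
    rw [hqe] at this
    exact haA (by simpa using this)
  have hadd : ∀ᶠ x in (q : Filter S), ∀ᶠ y in (q : Filter S), x + y = e := by
    rw [← Ultrafilter.eventually_add q q (· = e), hqe]
    simp
  have hgood : ∀ᶠ x in (q : Filter S),
      c x = i ∧ x + e = e ∧ ∀ᶠ y in (q : Filter S), x + y = e := by
    filter_upwards [hadd, htail q hq] with x hx hxa
    refine ⟨(hi x (haA hxa)).1, ?_, hx⟩
    obtain ⟨y, hy⟩ := hx.exists
    rw [← hy, ← add_assoc, hidem x hxa]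
  obtain ⟨b, hb, hbb⟩ := exists_seq_of_forall_finset_exists
    (fun x : S => c x = i ∧ x + e = e ∧ ∀ᶠ y in (q : Filter S), x + y = e)
    (fun x y => y ≠ x ∧ x + y = e) (fun s hs => by
      have h : ∀ᶠ y in (q : Filter S), ∀ x ∈ s, y ≠ x ∧ x + y = e :=
        s.eventually_all.2 fun x hx => (hqf x).and (hs x hx).2.2
      obtain ⟨y, hy⟩ := (hgood.and h).exists
      exact ⟨y, hy⟩)
  refine ⟨i, e, fun he => ?_, (hi e heA).1, Set.range b, ?_, b, ?_, rfl,
    fun m n h => (hbb m n h).2, fun n => (hb n).2.1⟩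
  · have hv : ∀ s ∈ A, s = e := by
      intro s hs
      have h1 := (hi s hs).2.2
      rw [← (hi e heA).2.2, dif_pos he] at h1
      split_ifs at h1 with h
      simpa using h1
    have hmem : ∀ n, a.get n ∈ A := fun n => haA (Hindman.FS.singleton a n)
    exact absurd (ha ((hv _ (hmem 0)).trans (hv _ (hmem 1)).symm)) zero_ne_one
  · rintro _ ⟨n, rfl⟩
    exact (hb n).1
  · exact Function.Injective.of_lt_imp_ne fun m n h => (hbb m n h).1.symm

end

theorem mainTheorem2 {S : Type*} [AddSemigroup S]
    (hS : ∀ (r : ℕ) (c : S → Fin r), ∃ A : Set S, IsProperIP A ∧ IsMonochromatic c A)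
    (r : ℕ) (c : S → Fin r) :
    ∃ A : ℕ → Set S,
      (∀ n, IsProperIP (A n)) ∧
      (∀ m n, m ≠ n → Disjoint (A m) (A n)) ∧
      IsMonochromatic c (⋃ n, A n) := by
  by_cases hno : ∀ p : Ultrafilter S, p.IsFree → p + p ≠ p
  · obtain ⟨i, hi⟩ : ∃ i : Fin r, ∀ F : Set S, F.Finite → ∃ e ∉ F, ∃ B : Set S, B.Infinite ∧
        c e = i ∧ (∀ x ∈ B, c x = i) ∧ IsNilEnumerable e B := by
      -- If every color failed outside some finite set, the union of these sets would contradict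
      -- `exists_isNilEnumerable`.
      by_contra! hcon
      choose F hF hFe using hcon
      obtain ⟨i, e, he, hce, B, hcB, hB⟩ :=
        exists_isNilEnumerable hS hno c (Set.finite_iUnion hF)
      refine hFe i e (fun h => he (Set.mem_iUnion_of_mem i h)) B ?_ hce hcB hB
      obtain ⟨b, hb, rfl, -⟩ := hB
      exact Set.infinite_range_of_injective hb
    obtain ⟨e, B, Y, hQ, hYB, hY, hdisj⟩ := exists_disjoint_refinement _ hi
    refine ⟨fun n => insert (e n) (Y n), fun n => (hQ n).2.2.isProperIP (hYB n) (hY n), hdisj,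
      i, fun s hs => ?_⟩
    obtain ⟨n, rfl | h⟩ := Set.mem_iUnion.1 hs
    · exact (hQ n).1
    · exact (hQ n).2.1 s (hYB n h)
  · push Not at hno
    obtain ⟨p, hp, hpp⟩ := hno
    obtain ⟨i, hi⟩ : ∃ i, ∀ᶠ x in (p : Filter S), c x = i := by
      by_contra! hcon
      have : ∀ᶠ x in (p : Filter S), ∀ i, c x ≠ i :=
        eventually_all.2 hcon
      obtain ⟨x, hx⟩ := this.exists
      exact hx _ rfl
    exact exists_disjoint_isProperIP_of_idempotent hp hpp hi
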